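/- Let $T$ be an infinite, locally finite tree that is leafless, i.e. has no vertex of valency $1$. Write $VT$ for its vertex set, $ET$ for its set of oriented edges and, for $v \in VT$, $E(v)$ for the set of oriented edges with origin $v$. Give $\mathrm{Aut}(T)$ the topology of pointwise convergence for its action on the discrete set $VT \sqcup ET$. Let $G$ be a topological group acting continuously on $T$ by automorphisms, i.e. through a continuous homomorphism $G \to \mathrm{Aut}(T)$, with finitely many orbits of vertices. For $v \in VT$, let $F(v) \leq \mathrm{Sym}(E(v))$ be the local action of $G$ at $v$, i.e. the permutation group induced on $E(v)$ by the stabilizer of $v$ in $G$. Suppose that for every $v \in VT$ the subgroup of $F(v)$ generated by the stabilizers $F(v)_e$, $e \in E(v)$, is not transitive on $E(v)$. Then $G$ is virtually indicable: there are an open subgroup $U \leq G$ of finite index and a continuous surjective homomorphism $U \to \mathbf{Z}$, where $\mathbf{Z}$ is discrete. -/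

import Mathlib

namespace TreeAction

variable {V : Type*} {T : SimpleGraph V}

/-- The automorphism `a` acting on oriented edges: `(u, w)` is sent to `(a u, a w)`. -/
def mapEdge (a : T ≃g T) (e : T.Dart) : T.Dart :=
  ⟨(a e.fst, a e.snd), a.map_rel_iff.2 e.adj⟩

/-- The topology of pointwise convergence on the automorphism group, for its action on the
vertices and on the oriented edges, both viewed as discrete sets. -/
instance autTopology : TopologicalSpace (T ≃g T) :=
  TopologicalSpace.induced (fun a : T ≃g T => (fun v : V => a v))
      (@Pi.topologicalSpace V (fun _ => V) (fun _ => ⊥)) ⊓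
    TopologicalSpace.induced (fun a : T ≃g T => (fun e : T.Dart => mapEdge a e))
      (@Pi.topologicalSpace T.Dart (fun _ => T.Dart) (fun _ => ⊥))

/-- The set `E(v)` of oriented edges with origin `v`. -/
def EdgesAt (T : SimpleGraph V) (v : V) : Type _ := {e : T.Dart // e.fst = v}

variable {G : Type*} [Group G]

/-- The stabilizer in `G` of the vertex `v`. -/
def vertexStabilizer (φ : G →* (T ≃g T)) (v : V) : Subgroup G where
  carrier := {g | φ g v = v}
  one_mem' := by simp
  mul_mem' := by
    intro a b ha hb
    simp only [Set.mem_ofPred_eq, map_mul, RelIso.mul_apply] at *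
    rw [hb, ha]
  inv_mem' := by
    intro a ha
    simp only [Set.mem_ofPred_eq, map_inv] at *
    conv_lhs => rw [← ha]
    exact RelIso.inv_apply_self _ _

/-- The action of the stabilizer of `v` on the set of edges with origin `v`. -/
def edgeAction (φ : G →* (T ≃g T)) (v : V) :
    vertexStabilizer φ v →* Equiv.Perm (EdgesAt T v) :=
  letI : MulAction (vertexStabilizer φ v) (EdgesAt T v) :=
    { smul := fun g e => ⟨mapEdge (φ g) e.1, (congrArg (φ (g : G)) e.2).trans g.2⟩
      one_smul := by
        rintro ⟨⟨⟨x, y⟩, h⟩, rfl⟩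
        apply Subtype.ext
        apply SimpleGraph.Dart.ext
        change (φ (1 : G) x, φ (1 : G) y) = (x, y)
        simp
      mul_smul := by
        rintro g h ⟨⟨⟨x, y⟩, hxy⟩, hx⟩
        apply Subtype.ext
        apply SimpleGraph.Dart.ext
        change (φ ((g : G) * h) x, φ ((g : G) * h) y) = (φ g (φ h x), φ g (φ h y))
        simp }
  MulAction.toPermHom _ _

/-- The local action `F(v) ≤ Sym(E(v))`. -/
def localAction (φ : G →* (T ≃g T)) (v : V) : Subgroup (Equiv.Perm (EdgesAt T v)) :=
  (edgeAction φ v).range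

/-- For a permutation group `F ≤ Sym(Ω)`, the subgroup generated by its point stabilizers. -/
def pointStabilizerSubgroup {Ω : Type*} (F : Subgroup (Equiv.Perm Ω)) :
    Subgroup (Equiv.Perm Ω) :=
  Subgroup.closure {σ | σ ∈ F ∧ ∃ x, σ x = x}

/-- The orbit of the vertex `v` under `G`. -/
def vertexOrbit (φ : G →* (T ≃g T)) (v : V) : Set V := Set.range fun g => φ g v

/-- Some open subgroup of finite index has a continuous surjective homomorphism onto `ℤ`. -/
def VirtuallyIndicable (G : Type*) [Group G] [TopologicalSpace G] : Prop :=
  ∃ U : Subgroup G, IsOpen (U : Set G) ∧ U.FiniteIndex ∧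
    ∃ f : U →* Multiplicative ℤ, Continuous f ∧ Function.Surjective f

end TreeAction

/-!
A `G`-invariant cocycle on the oriented edges of the tree, with values in a group `K`, has a
potential, unique up to a left translation; hence `G` permutes the potentials through a
homomorphism `G → K`, which kills all stabilizers of oriented edges.

This is used three times. The local quotients, that is, the vertex stabilizers modulo the subgroups
generated by the stabilizers of incident edges, are finite and glue to a cocycle: turning around a
vertex is measured in its local quotient. Together with the parity of a path this gives a
subgroup `U` of finite index that contains the edge stabilizers, acts without inversions and has
vertex stabilizers inside those subgroups. By the hypothesis on the local actions, the finite
quotient graph of `T` by `U` then has no leaf, so it contains a simple closed path. Counting signed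
crossings with the orbit of an edge of this path gives the third cocycle, and its homomorphism
`U → ℤ` takes the value `1` on an element that closes up a lift of the path.
-/

namespace TreeAction

open MulAction SimpleGraph

section LocalQuotients

variable {G V D : Type*} [Group G] [MulAction G V] [MulAction G D]

/-- The orbit of `v`, as a point of the quotient by the action. -/
abbrev orbitClass (G : Type*) {V : Type*} [Group G] [MulAction G V] (v : V) :
    orbitRel.Quotient G V :=
  Quotient.mk (orbitRel G V) v

theorem orbitClass_eq_iff {v w : V} : orbitClass G v = orbitClass G w ↔ ∃ g : G, g • w = v :=
  Quotient.eq

theorem exists_smul_out (v : V) : ∃ g : G, g • (orbitClass G v).out = v :=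
  orbitClass_eq_iff.1 (Quotient.out_eq _).symm

/-- The subgroup generated by the stabilizers of the points of the fibre over `v`. For the origin
map of oriented edges it is the preimage, in the stabilizer of `v`, of the subgroup of the local
action generated by point stabilizers. -/
def fiberStabilizers (src : D →[G] V) (v : V) : Subgroup G :=
  ⨆ d : {d // src d = v}, stabilizer G d.1

variable (src : D →[G] V)

theorem stabilizer_le_fiberStabilizers (d : D) :
    stabilizer G d ≤ fiberStabilizers src (src d) :=
  le_iSup (fun e : {e // src e = src d} => stabilizer G e.1) ⟨d, rfl⟩

theorem fiberStabilizers_le_stabilizer (v : V) : fiberStabilizers src v ≤ stabilizer G v := by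
  refine iSup_le ?_
  rintro ⟨d, rfl⟩ g hg
  rw [mem_stabilizer_iff, ← map_smul, mem_stabilizer_iff.1 hg]

variable {src} in
theorem conj_mem_fiberStabilizers {v : V} {g : G} (hg : g ∈ fiberStabilizers src v) (h : G) :
    h * g * h⁻¹ ∈ fiberStabilizers src (h • v) := by
  suffices fiberStabilizers src v ≤
      (fiberStabilizers src (h • v)).comap (MulAut.conj h).toMonoidHom from this hg
  refine iSup_le ?_
  rintro ⟨d, rfl⟩ k hk
  rw [← map_smul]
  apply stabilizer_le_fiberStabilizers src (h • d)
  simp [mul_smul, mem_stabilizer_iff.1 hk]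

instance normal_fiberStabilizers (v : V) :
    ((fiberStabilizers src v).subgroupOf (stabilizer G v)).Normal where
  conj_mem g hg h := by
    have hconj := conj_mem_fiberStabilizers (Subgroup.mem_subgroupOf.1 hg) (h : G)
    rwa [mem_stabilizer_iff.1 h.2] at hconj

variable {src} in
theorem finiteIndex_fiberStabilizers {d : D} (hfin : (src ⁻¹' {src d}).Finite) :
    ((fiberStabilizers src (src d)).subgroupOf (stabilizer G (src d))).FiniteIndex := by
  have horbit : orbit (stabilizer G (src d)) d ⊆ src ⁻¹' {src d} := by
    rintro _ ⟨g, rfl⟩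
    exact (map_smul src (g : G) d).trans g.2
  have : (stabilizer (stabilizer G (src d)) d).FiniteIndex := ⟨by
    rw [index_stabilizer, ← pos_iff_ne_zero, Set.ncard_pos (hfin.subset horbit)]
    exact nonempty_orbit d⟩
  exact Subgroup.finiteIndex_of_le (H := stabilizer (stabilizer G (src d)) d)
    fun g hg => stabilizer_le_fiberStabilizers src d hg

/-- The product over the orbits of `V` of the vertex stabilizers modulo their subgroups
`fiberStabilizers`: a common target for the local quotients at all orbit representatives. -/
abbrev LocalQuotients : Type _ :=
  ∀ i : orbitRel.Quotient G V,
    stabilizer G i.out ⧸ (fiberStabilizers src i.out).subgroupOf (stabilizer G i.out)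

variable {src} in
theorem finite_localQuotients [Finite (orbitRel.Quotient G V)]
    (hfin : ∀ v, (src ⁻¹' {v}).Finite) (hsurj : Function.Surjective src) :
    Finite (LocalQuotients src) := by
  have (i : orbitRel.Quotient G V) :
      ((fiberStabilizers src i.out).subgroupOf (stabilizer G i.out)).FiniteIndex := by
    obtain ⟨d, hd⟩ := hsurj i.out
    rw [← hd]
    exact finiteIndex_fiberStabilizers (hfin _)
  infer_instance

open Classical in
/-- The projection of the stabilizer of the representative of the orbit `i` to its local quotient,
viewed as the factor with index `i`. -/
noncomputable def localHom (i : orbitRel.Quotient G V) :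
    stabilizer G i.out →* LocalQuotients src :=
  (MonoidHom.mulSingle _ i).comp (QuotientGroup.mk' _)

/-- The map `localHom` as a function on all of `G`, with the junk value `1` outside the stabilizer
of the orbit representative. -/
noncomputable def localClass (i : orbitRel.Quotient G V) : G → LocalQuotients src :=
  Function.extend Subtype.val (localHom src i) 1

variable {src} {i : orbitRel.Quotient G V} {g h : G}

theorem localClass_of_mem (hg : g ∈ stabilizer G i.out) :
    localClass src i g = localHom src i ⟨g, hg⟩ :=
  Subtype.val_injective.extend_apply _ _ ⟨g, hg⟩

theorem localClass_mul (hg : g ∈ stabilizer G i.out) (hh : h ∈ stabilizer G i.out) :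
    localClass src i (g * h) = localClass src i g * localClass src i h := by
  rw [localClass_of_mem hg, localClass_of_mem hh, localClass_of_mem (mul_mem hg hh), ← map_mul]
  rfl

theorem localClass_eq_one_iff (hg : g ∈ stabilizer G i.out) :
    localClass src i g = 1 ↔ g ∈ fiberStabilizers src i.out := by
  classical
  rw [localClass_of_mem hg]
  exact Pi.mulSingle_eq_one_iff.trans
    ((QuotientGroup.eq_one_iff _).trans Subgroup.mem_subgroupOf)

variable (src) in
/-- Choose an element `frame d` at one representative `d` of each orbit of `D` and spread it by
translation: the ambiguity of the translating element lies in a point stabilizer. -/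
theorem exists_frame : ∃ frame : D → G,
    (∀ d, frame d • (orbitClass G (src d)).out = src d) ∧
    ∀ (g : G) d, (frame (g • d))⁻¹ * g * frame d ∈
      fiberStabilizers src (orbitClass G (src d)).out := by
  choose x hx using fun d : D => exists_smul_out (G := G) d
  choose y hy using fun v : V => exists_smul_out (G := G) v
  let r (d : D) : D := (orbitClass G d).out
  have hr (g : G) (d : D) : r (g • d) = r d :=
    congrArg Quotient.out (orbitClass_eq_iff.2 ⟨g, rfl⟩)
  let frame (d : D) : G := x d * y (src (r d))
  have hframe (d : D) : frame d • (orbitClass G (src d)).out = src d := by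
    have hclass : orbitClass G (src d) = orbitClass G (src (r d)) :=
      orbitClass_eq_iff.2 ⟨x d, by rw [← map_smul, hx]⟩
    rw [hclass, mul_smul, hy, ← map_smul, hx]
  have hpull (d : D) : (frame d)⁻¹ • d = (y (src (r d)))⁻¹ • r d := by
    rw [mul_inv_rev, mul_smul, inv_smul_eq_iff.2 (hx d).symm]
  refine ⟨frame, hframe, fun g d => ?_⟩
  have hfix : (frame (g • d))⁻¹ * g * frame d ∈ stabilizer G ((frame d)⁻¹ • d) := by
    rw [mem_stabilizer_iff, mul_smul, smul_inv_smul, mul_smul, hpull, hpull, hr]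
  have hsrc : src ((frame d)⁻¹ • d) = (orbitClass G (src d)).out := by
    rw [map_smul, inv_smul_eq_iff, hframe]
  exact hsrc ▸ stabilizer_le_fiberStabilizers src _ hfix

variable (src) in
/-- `δ a b` is the class of `(frame a)⁻¹ * frame b` in the local quotient. -/
theorem exists_localCocycle : ∃ δ : D → D → LocalQuotients src,
    (∀ a b c, src a = src b → src b = src c → δ a b * δ b c = δ a c) ∧
    (∀ (g : G) a b, src a = src b → δ (g • a) (g • b) = δ a b) ∧
    ∀ d, ∀ g ∈ stabilizer G (src d), δ d (g • d) = 1 → g ∈ fiberStabilizers src (src d) := by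
  obtain ⟨frame, hframe, hsmul⟩ := exists_frame src
  have hmem {a b : D} (hab : src a = src b) :
      (frame a)⁻¹ * frame b ∈ stabilizer G (orbitClass G (src a)).out := by
    rw [mem_stabilizer_iff, mul_smul, inv_smul_eq_iff, hframe, hab, hframe]
  refine ⟨fun a b => localClass src (orbitClass G (src a)) ((frame a)⁻¹ * frame b),
    fun a b c hab hbc => ?_, fun g a b hab => ?_, fun d g hg hone => ?_⟩
  · simp only [← hab]
    rw [← localClass_mul (hmem hab) (hab ▸ hmem hbc)]
    group
  · have hclass : orbitClass G (src (g • a)) = orbitClass G (src a) :=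
      orbitClass_eq_iff.2 ⟨g, (map_smul src g a).symm⟩
    have ha := hsmul g a
    have hb := inv_mem (hab ▸ hsmul g b)
    have hle := fiberStabilizers_le_stabilizer src (orbitClass G (src a)).out
    have hfactor : (frame (g • a))⁻¹ * frame (g • b) = (frame (g • a))⁻¹ * g * frame a *
        ((frame a)⁻¹ * frame b) * ((frame (g • b))⁻¹ * g * frame b)⁻¹ := by group
    dsimp only
    rw [hclass, hfactor, localClass_mul (mul_mem (hle ha) (hmem hab)) (hle hb),
      localClass_mul (hle ha) (hmem hab), (localClass_eq_one_iff (hle ha)).2 ha,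
      (localClass_eq_one_iff (hle hb)).2 hb, one_mul, mul_one]
  · have hgd : src d = src (g • d) := by rw [map_smul, mem_stabilizer_iff.1 hg]
    have hconj := conj_mem_fiberStabilizers
      (mul_mem ((localClass_eq_one_iff (hmem hgd)).1 hone) (hsmul g d)) (frame d)
    rw [hframe] at hconj
    convert hconj using 1
    group

end LocalQuotients

section Cocycle

variable {V K : Type*} [Group K] {T : SimpleGraph V}

/-- A `K`-valued cocycle on the oriented edges of a graph. It is given on the two kinds of moves
that generate all changes of oriented edge: turning around the common origin of two edges, and
reversing the orientation. -/
structure DartCocycle (T : SimpleGraph V) (K : Type*) [Group K] where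
  turn : T.Dart → T.Dart → K
  flip : T.Dart → K
  turn_mul_turn {a b c : T.Dart} :
    a.fst = b.fst → b.fst = c.fst → turn a b * turn b c = turn a c
  flip_symm (d : T.Dart) : flip d.symm = (flip d)⁻¹

namespace DartCocycle

variable (c : DartCocycle T K)

/-- A potential of a cocycle: a labelling of the oriented edges whose variation is prescribed by
the cocycle. -/
structure IsPotential (l : T.Dart → K) : Prop where
  turn {a b : T.Dart} : a.fst = b.fst → l b = l a * c.turn a b
  flip (d : T.Dart) : l d.symm = l d * c.flip d

theorem turn_self (d : T.Dart) : c.turn d d = 1 :=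
  mul_eq_left.1 (c.turn_mul_turn (a := d) rfl rfl)

theorem turn_inv {a b : T.Dart} (h : a.fst = b.fst) : (c.turn a b)⁻¹ = c.turn b a :=
  inv_eq_of_mul_eq_one_right ((c.turn_mul_turn h h.symm).trans (c.turn_self a))

end DartCocycle

theorem exists_potential_of_isTree (hT : T.IsTree) (c : T.Dart → K)
    (hc : ∀ d, c d.symm = (c d)⁻¹) :
    ∃ s : V → K, ∀ d : T.Dart, s d.snd = s d.fst * c d := by
  obtain ⟨v₀⟩ := hT.connected.nonempty
  choose p hp _ using hT.existsUnique_path v₀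
  let s (v : V) : K := ((p v).darts.map c).prod
  have hforward (d : T.Dart) (hd : d.fst ∈ (p d.snd).support) : s d.snd = s d.fst * c d := by
    simp only [s, hT.isAcyclic.path_concat (hp d.fst) (hp d.snd) d.adj hd, Walk.darts_concat,
      List.concat_eq_append, List.map_append, List.prod_append, List.map_singleton,
      List.prod_singleton]
  refine ⟨s, fun d => ?_⟩
  by_cases hd : d.fst ∈ (p d.snd).support
  · exact hforward d hd
  · have hback := hforward d.symm
      (hT.isAcyclic.mem_support_of_ne_mem_support_of_adj_of_isPath (hp d.fst) (hp d.snd) d.adj hd)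
    rw [hc] at hback
    exact eq_mul_inv_iff_mul_eq.1 hback |>.symm

theorem DartCocycle.exists_isPotential (hT : T.IsTree)
    (hsurj : Function.Surjective fun d : T.Dart => d.fst) (c : DartCocycle T K) :
    ∃ l, c.IsPotential l := by
  choose b hb using hsurj
  obtain ⟨s, hs⟩ := exists_potential_of_isTree hT
    (fun d => c.turn (b d.fst) d * c.flip d * c.turn d.symm (b d.snd)) fun d => by
      rw [mul_inv_rev, mul_inv_rev, c.turn_inv (hb d.fst), c.turn_inv (hb d.snd).symm,
        ← c.flip_symm, ← mul_assoc]
      rfl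
  refine ⟨fun d => s d.fst * c.turn (b d.fst) d, fun {x y} hxy => ?_, fun d => ?_⟩
  · rw [← hxy, mul_assoc, c.turn_mul_turn (hb _) hxy]
  · have hturn : c.turn d.symm (b d.snd) * c.turn (b d.snd) d.symm = 1 :=
      (c.turn_mul_turn (a := d.symm) (hb d.snd).symm (hb d.snd)).trans (c.turn_self _)
    change s d.snd * c.turn (b d.snd) d.symm = _
    simp only [hs, mul_assoc, hturn, mul_one]

theorem eq_of_forall_turn_flip {Y : Type*} (hT : T.Connected) {f : T.Dart → Y}
    (hturn : ∀ a b, a.fst = b.fst → f a = f b) (hflip : ∀ d, f d.symm = f d) (a b : T.Dart) :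
    f a = f b := by
  suffices ∀ {v w : V} (_ : T.Walk v w) (a b : T.Dart), a.fst = v → b.fst = w → f a = f b from
    this (hT.preconnected a.fst b.fst).some a b rfl rfl
  intro v w p
  induction p with
  | nil => exact fun a b ha hb => hturn a b (ha.trans hb.symm)
  | cons hadj _ ih =>
    exact fun a b ha hb => (hturn a ⟨(_, _), hadj⟩ ha).trans
      ((hflip _).symm.trans (ih _ b rfl hb))

end Cocycle

section GraphAction

/-- An action on the vertices of a graph that preserves adjacency. -/
class GraphAction (G : Type*) {V : Type*} (T : SimpleGraph V) [Group G] [MulAction G V] :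
    Prop where
  adj_smul (g : G) {v w : V} : T.Adj v w → T.Adj (g • v) (g • w)

variable {G V K : Type*} [Group G] [MulAction G V] [Group K] {T : SimpleGraph V}
  [GraphAction G T]

instance dartMulAction : MulAction G T.Dart where
  smul g d := ⟨(g • d.fst, g • d.snd), GraphAction.adj_smul g d.adj⟩
  one_smul d := Dart.ext _ _ (Prod.ext (one_smul G d.fst) (one_smul G d.snd))
  mul_smul g h d := Dart.ext _ _ (Prod.ext (mul_smul g h d.fst) (mul_smul g h d.snd))

instance subgroupGraphAction (U : Subgroup G) : GraphAction U T :=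
  ⟨fun g => GraphAction.adj_smul (g : G)⟩

theorem fst_smul (g : G) (d : T.Dart) : (g • d).fst = g • d.fst := rfl

theorem symm_smul (g : G) (d : T.Dart) : (g • d).symm = g • d.symm := rfl

/-- The origin of oriented edges as an equivariant map. -/
def dartOrigin (G : Type*) {V : Type*} [Group G] [MulAction G V] (T : SimpleGraph V)
    [GraphAction G T] : T.Dart →[G] V where
  toFun d := d.fst
  map_smul' := fst_smul

/-- Invariance of a cocycle under a group acting on the graph. -/
structure DartCocycle.IsInvariant (G : Type*) [Group G] [MulAction G V] [GraphAction G T]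
    (c : DartCocycle T K) : Prop where
  turn_smul (g : G) {a b : T.Dart} : a.fst = b.fst → c.turn (g • a) (g • b) = c.turn a b
  flip_smul (g : G) (d : T.Dart) : c.flip (g • d) = c.flip d

theorem exists_hom_of_forall_smul_div_eq {X : Type*} [MulAction G X] {l : X → K}
    (h : ∀ (g : G) x y, l (g • x) / l x = l (g • y) / l y) :
    ∃ θ : G →* K, ∀ g x, l (g • x) = θ g * l x := by
  rcases isEmpty_or_nonempty X with hX | ⟨⟨x₀⟩⟩
  · exact ⟨1, fun _ => hX.elim⟩
  refine ⟨MonoidHom.mk' (fun g => l (g • x₀) / l x₀) fun g k => ?_, fun g x => ?_⟩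
  · rw [h g x₀ (k • x₀), mul_smul, div_mul_div_cancel]
  · rw [MonoidHom.mk'_apply, h g x₀ x, div_mul_cancel]

theorem DartCocycle.IsPotential.exists_hom {c : DartCocycle T K} {l : T.Dart → K}
    (hl : c.IsPotential l) (hT : T.Connected) (hc : c.IsInvariant G) :
    ∃ θ : G →* K, ∀ g d, l (g • d) = θ g * l d := by
  refine exists_hom_of_forall_smul_div_eq fun g => eq_of_forall_turn_flip hT ?_ ?_
  · intro a b hab
    have hgab : (g • a).fst = (g • b).fst := by rw [fst_smul, fst_smul, hab]
    rw [hl.turn hab, hl.turn hgab, hc.turn_smul g hab, mul_div_mul_right_eq_div]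
  · intro d
    rw [← symm_smul, hl.flip, hl.flip, hc.flip_smul, mul_div_mul_right_eq_div]

theorem stabilizer_le_ker_of_forall_smul_eq {X : Type*} [MulAction G X] {l : X → K}
    {θ : G →* K} (h : ∀ g x, l (g • x) = θ g * l x) (x : X) : stabilizer G x ≤ θ.ker :=
  fun g hg => mul_eq_right.1 ((h g x).symm.trans (congrArg l hg))

theorem exists_subgroup_inf_stabilizer_le_fiberStabilizers [Finite (orbitRel.Quotient G V)]
    (hT : T.IsTree) (hsurj : Function.Surjective (dartOrigin G T))
    (hfin : ∀ v, (dartOrigin G T ⁻¹' {v}).Finite) :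
    ∃ U : Subgroup G, U.FiniteIndex ∧ (∀ d : T.Dart, stabilizer G d ≤ U) ∧
      ∀ v, U ⊓ stabilizer G v ≤ fiberStabilizers (dartOrigin G T) v := by
  have := finite_localQuotients hfin hsurj
  obtain ⟨δ, hmul, hsmul, hmem⟩ := exists_localCocycle (dartOrigin G T)
  let c : DartCocycle T (LocalQuotients (dartOrigin G T)) :=
    { turn := δ
      flip := 1
      turn_mul_turn := hmul _ _ _
      flip_symm := fun _ => inv_one.symm }
  obtain ⟨l, hl⟩ := c.exists_isPotential hT hsurj
  obtain ⟨θ, hθ⟩ := hl.exists_hom (G := G) hT.connected ⟨fun g _ _ => hsmul g _ _, fun _ _ => rfl⟩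
  refine ⟨θ.ker, inferInstance, stabilizer_le_ker_of_forall_smul_eq hθ, fun v g hg => ?_⟩
  obtain ⟨d, rfl⟩ := hsurj v
  have hfst : d.fst = (g • d).fst := (mem_stabilizer_iff.1 hg.2).symm
  refine hmem d g hg.2 (mul_eq_left.1 ((hl.turn hfst).symm.trans ?_))
  rw [hθ, MonoidHom.mem_ker.1 hg.1, one_mul]

theorem exists_subgroup_smul_ne_symm (hT : T.IsTree)
    (hsurj : Function.Surjective (dartOrigin G T)) :
    ∃ U : Subgroup G, U.FiniteIndex ∧ (∀ d : T.Dart, stabilizer G d ≤ U) ∧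
      ∀ g ∈ U, ∀ d : T.Dart, g • d ≠ d.symm := by
  let c : DartCocycle T ℤˣ :=
    { turn := 1
      flip := fun _ => -1
      turn_mul_turn := fun _ _ => rfl
      flip_symm := fun _ => rfl }
  obtain ⟨l, hl⟩ := c.exists_isPotential hT hsurj
  obtain ⟨θ, hθ⟩ := hl.exists_hom (G := G) hT.connected ⟨fun _ _ _ _ => rfl, fun _ _ => rfl⟩
  refine ⟨θ.ker, inferInstance, stabilizer_le_ker_of_forall_smul_eq hθ, fun g hg d hd => ?_⟩
  have hone : l d = l d * -1 := by
    rw [← hl.flip d, ← hd, hθ, MonoidHom.mem_ker.1 hg, one_mul]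
  exact absurd (mul_eq_left.1 hone.symm) (by decide)

end GraphAction

section Integers

variable {G V : Type*} [Group G] [MulAction G V] {T : SimpleGraph V} [GraphAction G T]

/-- The number of times, counted with sign, that the oriented edge `d` runs through the orbit of
`x`: the value is `1` on the orbit of `x` and `-1` on the orbit of `x.symm`, and these cancel if
the two orbits coincide. -/
noncomputable def signedCrossing (G : Type*) [Group G] [MulAction G V] [GraphAction G T]
    (x d : T.Dart) : ℤ :=
  (orbit G x).indicator 1 d - (orbit G x).indicator 1 d.symm

theorem signedCrossing_symm (x d : T.Dart) :
    signedCrossing G x d.symm = -signedCrossing G x d := by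
  rw [signedCrossing, signedCrossing, Dart.symm_symm, neg_sub]

theorem signedCrossing_smul (g : G) (x d : T.Dart) :
    signedCrossing G x (g • d) = signedCrossing G x d := by
  simp only [signedCrossing, Set.indicator, symm_smul, ← orbit_eq_iff, orbit_smul, Pi.one_apply]

theorem signedCrossing_self {x : T.Dart} (h : x.symm ∉ orbit G x) : signedCrossing G x x = 1 := by
  rw [signedCrossing, Set.indicator_of_mem (mem_orbit_self x), Set.indicator_of_notMem h]
  rfl

theorem signedCrossing_eq_zero {x d : T.Dart} (h : d ∉ orbit G x) (hsymm : d.symm ∉ orbit G x) :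
    signedCrossing G x d = 0 := by
  rw [signedCrossing, Set.indicator_of_notMem h, Set.indicator_of_notMem hsymm, sub_zero]

/-- The cocycle counting signed crossings with the orbit of `x` along a walk. -/
noncomputable def crossingCocycle (G : Type*) [Group G] [MulAction G V] [GraphAction G T]
    (x : T.Dart) : DartCocycle T (Multiplicative ℤ) where
  turn := 1
  flip d := .ofAdd (signedCrossing G x d)
  turn_mul_turn _ _ := rfl
  flip_symm d := by rw [signedCrossing_symm, ofAdd_neg]

theorem crossingCocycle_isInvariant (x : T.Dart) : (crossingCocycle G x).IsInvariant G where
  turn_smul _ _ _ _ := rfl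
  flip_smul g d := congrArg Multiplicative.ofAdd (signedCrossing_smul g x d)

theorem exists_nonbacktracking_seq [Nonempty T.Dart]
    (h : ∀ d : T.Dart, ∃ e : T.Dart, e.fst = d.fst ∧ e ∉ orbit G d) :
    ∃ y : ℕ → T.Dart, (∀ n, (y (n + 1)).fst = (y n).snd) ∧
      ∀ n, y (n + 1) ∉ orbit G (y n).symm := by
  choose next hnext using fun d : T.Dart => h d.symm
  refine ⟨fun n => next^[n] (Classical.arbitrary _), fun n => ?_, fun n => ?_⟩ <;>
    simp only [Function.iterate_succ_apply']
  exacts [(hnext _).1, (hnext _).2]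

theorem exists_lt_map_eq_injOn {α : Type*} [Finite α] (a : ℕ → α) :
    ∃ m n, m < n ∧ a m = a n ∧ Set.InjOn a (Set.Iio n) := by
  classical
  have hrepeat : ∃ n, ∃ m < n, a m = a n := by
    obtain ⟨m, n, hne, heq⟩ := Finite.exists_ne_map_eq_of_infinite a
    rcases hne.lt_or_gt with hlt | hlt
    exacts [⟨n, m, hlt, heq⟩, ⟨m, n, hlt, heq.symm⟩]
  obtain ⟨m, hlt, heq⟩ := Nat.find_spec hrepeat
  refine ⟨m, Nat.find hrepeat, hlt, heq, fun i hi j hj hij => ?_⟩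
  by_contra! hne
  rcases hne.lt_or_gt with hlt | hlt
  exacts [Nat.find_min hrepeat hj ⟨i, hlt, hij⟩, Nat.find_min hrepeat hi ⟨j, hlt, hij.symm⟩]

/-- Crossing the orbit of `y m` backwards at time `j` would force `j = m + 1`, hence a
backtracking. -/
theorem signedCrossing_eq_zero_of_injOn {y : ℕ → T.Dart}
    (hstep : ∀ n, (y (n + 1)).fst = (y n).snd) (hback : ∀ n, y (n + 1) ∉ orbit G (y n).symm)
    {m n : ℕ} (hinj : Set.InjOn (fun k => orbitClass G (y k).fst) (Set.Iio n)) {j : ℕ}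
    (hmj : m < j) (hjn : j < n) : signedCrossing G (y m) (y j) = 0 := by
  refine signedCrossing_eq_zero ?_ ?_
  · rintro ⟨g, hg⟩
    have hclass : orbitClass G (y j).fst = orbitClass G (y m).fst :=
      orbitClass_eq_iff.2 ⟨g, congrArg (fun d : T.Dart => d.fst) hg⟩
    exact hmj.ne' (hinj hjn (hmj.trans hjn) hclass)
  · rintro ⟨g, hg⟩
    have hreverse : g • (y m).symm = y j := by
      rw [← symm_smul, show g • y m = _ from hg, Dart.symm_symm]
    have hclass : orbitClass G (y j).fst = orbitClass G (y (m + 1)).fst :=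
      orbitClass_eq_iff.2 ⟨g, hstep m ▸ congrArg (fun d : T.Dart => d.fst) hreverse⟩
    obtain rfl : j = m + 1 := hinj hjn (lt_of_le_of_lt hmj hjn) hclass
    exact hback m ⟨g, hreverse⟩

theorem DartCocycle.IsPotential.eq_mul_ofAdd_signedCrossing {x : T.Dart}
    {l : T.Dart → Multiplicative ℤ} (hl : (crossingCocycle G x).IsPotential l) {d e : T.Dart}
    (h : e.fst = d.snd) : l e = l d * .ofAdd (signedCrossing G x d) := by
  rw [hl.turn (a := d.symm) h.symm, hl.flip]
  exact mul_one _

theorem exists_surjective_hom_int [Finite (orbitRel.Quotient G V)] (hT : T.IsTree)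
    (hsurj : Function.Surjective (dartOrigin G T))
    (hinv : ∀ (g : G) (d : T.Dart), g • d ≠ d.symm)
    (hloc : ∀ d : T.Dart, ∃ e : T.Dart, e.fst = d.fst ∧ e ∉ orbit G d) :
    ∃ f : G →* Multiplicative ℤ, Function.Surjective f ∧ ∀ d : T.Dart, stabilizer G d ≤ f.ker := by
  have : Nonempty T.Dart := hT.connected.nonempty.map (Function.surjInv hsurj)
  obtain ⟨y, hstep, hback⟩ := exists_nonbacktracking_seq hloc
  obtain ⟨m, n, hmn, hreturn, hinj⟩ := exists_lt_map_eq_injOn fun k => orbitClass G (y k).fst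
  obtain ⟨l, hl⟩ := (crossingCocycle G (y m)).exists_isPotential hT hsurj
  obtain ⟨θ, hθ⟩ := hl.exists_hom hT.connected (crossingCocycle_isInvariant (y m))
  have hwalk (k : ℕ) (hk : m + 1 ≤ k) : k ≤ n → l (y k) = l (y m) * .ofAdd 1 := by
    induction k, hk using Nat.le_induction with
    | base =>
      intro _
      rw [hl.eq_mul_ofAdd_signedCrossing (hstep m), signedCrossing_self fun ⟨g, hg⟩ => hinv g _ hg]
    | succ j hmj ih =>
      intro hjn
      rw [hl.eq_mul_ofAdd_signedCrossing (hstep j),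
        signedCrossing_eq_zero_of_injOn hstep hback hinj hmj hjn, ofAdd_zero, mul_one,
        ih (Nat.le_of_succ_le hjn)]
  obtain ⟨g, hg⟩ := orbitClass_eq_iff.1 hreturn.symm
  have hθg : θ g = .ofAdd 1 := by
    have hturn : l (y n) = l (g • y m) :=
      (hl.turn (a := g • y m) hg).trans (mul_one _)
    rw [hwalk n hmn le_rfl, hθ, mul_comm] at hturn
    exact (mul_right_cancel hturn).symm
  refine ⟨θ, fun k => ⟨g ^ k.toAdd, ?_⟩, stabilizer_le_ker_of_forall_smul_eq hθ⟩
  rw [map_zpow, hθg, ← ofAdd_zsmul, smul_eq_mul, mul_one, ofAdd_toAdd]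

end Integers

section Automorphisms

variable {G V : Type*} [Group G] [MulAction G V] {T : SimpleGraph V} {φ : G →* (T ≃g T)}

theorem finite_orbitRelQuotient_of_finite_vertexOrbits (h : ∀ g v, φ g v = g • v)
    (horb : (Set.range (vertexOrbit φ)).Finite) : Finite (orbitRel.Quotient G V) := by
  have horbit (v : V) : vertexOrbit φ v = orbit G v := congrArg Set.range (funext (h · v))
  have hsub : Set.range (orbitRel.Quotient.orbit (G := G) (α := V)) ⊆
      Set.range (vertexOrbit φ) := by
    rintro _ ⟨q, rfl⟩
    exact ⟨q.out, (horbit _).trans (q.orbit_eq_orbit_out Quotient.out_eq).symm⟩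
  have := (horb.subset hsub).to_subtype
  exact Finite.of_injective_finite_range orbitRel.Quotient.orbit_injective

theorem graphAction_of_forall_eq_smul (h : ∀ g v, φ g v = g • v) : GraphAction G T where
  adj_smul g v w hvw := h g v ▸ h g w ▸ (φ g).map_rel_iff.2 hvw

variable [GraphAction G T]

theorem mapEdge_eq_smul (h : ∀ g v, φ g v = g • v) (g : G) (d : T.Dart) :
    mapEdge (φ g) d = g • d :=
  Dart.ext _ _ (Prod.ext (h g d.fst) (h g d.snd))

theorem fiberStabilizers_dartOrigin_le (h : ∀ g v, φ g v = g • v) (v : V) :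
    fiberStabilizers (dartOrigin G T) v ≤
      ((pointStabilizerSubgroup (localAction φ v)).comap (edgeAction φ v)).map
        (vertexStabilizer φ v).subtype := by
  refine iSup_le ?_
  rintro ⟨d, hd⟩ g hg
  have hfix : mapEdge (φ g) d = d := (mapEdge_eq_smul h g d).trans hg
  have hgv : g ∈ vertexStabilizer φ v := hd ▸ congrArg (fun e : T.Dart => e.fst) hfix
  exact ⟨⟨g, hgv⟩, Subgroup.subset_closure ⟨⟨_, rfl⟩, ⟨d, hd⟩, Subtype.ext hfix⟩, rfl⟩

theorem exists_notMem_orbit_fiberStabilizers (h : ∀ g v, φ g v = g • v) {d : T.Dart}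
    (hloc : ¬ IsPretransitive (pointStabilizerSubgroup (localAction φ d.fst))
      (EdgesAt T d.fst)) :
    ∃ e : T.Dart, e.fst = d.fst ∧ e ∉ orbit (fiberStabilizers (dartOrigin G T) d.fst) d := by
  by_contra! htrans
  refine hloc ((isPretransitive_iff_base ⟨d, rfl⟩).2 fun e => ?_)
  obtain ⟨⟨g, hg⟩, hge⟩ := htrans e.1 e.2
  obtain ⟨k, hk, rfl⟩ := fiberStabilizers_dartOrigin_le h _ hg
  exact ⟨⟨_, hk⟩, Subtype.ext ((mapEdge_eq_smul h _ d).trans hge)⟩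

theorem exists_notMem_orbit_of_inf_stabilizer_le (h : ∀ g v, φ g v = g • v) {U : Subgroup G}
    {d : T.Dart} (hU : U ⊓ stabilizer G d.fst ≤ fiberStabilizers (dartOrigin G T) d.fst)
    (hloc : ¬ IsPretransitive (pointStabilizerSubgroup (localAction φ d.fst))
      (EdgesAt T d.fst)) :
    ∃ e : T.Dart, e.fst = d.fst ∧ e ∉ orbit U d := by
  obtain ⟨e, he, hne⟩ := exists_notMem_orbit_fiberStabilizers h hloc
  refine ⟨e, he, ?_⟩
  rintro ⟨u, rfl⟩
  exact hne ⟨⟨u, hU ⟨u.2, he⟩⟩, rfl⟩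

end Automorphisms

section Topology

variable {V G : Type*} {T : SimpleGraph V} [Group G] [TopologicalSpace G]

theorem isOpen_setOf_mapEdge_eq (d e : T.Dart) : IsOpen {a : T ≃g T | mapEdge a d = e} := by
  refine IsOpen.mono (t₂ := TopologicalSpace.induced (fun (a : T ≃g T) d => mapEdge a d)
    (@Pi.topologicalSpace T.Dart (fun _ => T.Dart) (fun _ => ⊥))) ?_ inf_le_right
  let _ : TopologicalSpace T.Dart := ⊥
  have : DiscreteTopology T.Dart := ⟨rfl⟩
  exact isOpen_induced_iff.2 ⟨(fun f : T.Dart → T.Dart => f d) ⁻¹' {e},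
    (isOpen_discrete {e}).preimage (continuous_apply d), rfl⟩

theorem isOpen_stabilizer_dart [MulAction G V] [GraphAction G T] {φ : G →* (T ≃g T)}
    (hφ : Continuous φ) (h : ∀ g v, φ g v = g • v) (d : T.Dart) :
    IsOpen (stabilizer G d : Set G) := by
  convert (isOpen_setOf_mapEdge_eq d d).preimage hφ using 1
  ext g
  exact (congrArg (· = d) (mapEdge_eq_smul h g d)).to_iff.symm

theorem continuous_of_isOpen_of_le_ker [IsTopologicalGroup G] {H : Type*} [MulOneClass H]
    [TopologicalSpace H] [DiscreteTopology H] {f : G →* H} {S : Subgroup G}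
    (hS : IsOpen (S : Set G)) (hle : S ≤ f.ker) : Continuous f := by
  refine continuous_of_continuousAt_one f ?_
  rw [ContinuousAt, map_one, nhds_discrete H, Filter.tendsto_pure]
  exact Filter.mem_of_superset (hS.mem_nhds S.one_mem) hle

end Topology

end TreeAction

open TreeAction MulAction in
theorem mainTheorem1 {V G : Type*} [Infinite V] (T : SimpleGraph V) (hT : T.IsTree)
    (hfin : ∀ v, Finite (TreeAction.EdgesAt T v))
    (hleaf : ∀ v, Nat.card (TreeAction.EdgesAt T v) ≠ 1)
    [Group G] [TopologicalSpace G] [IsTopologicalGroup G]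
    (φ : G →* (T ≃g T)) (hφ : Continuous φ)
    (horb : (Set.range (TreeAction.vertexOrbit φ)).Finite)
    (hloc : ∀ v, ¬ MulAction.IsPretransitive
      (TreeAction.pointStabilizerSubgroup (TreeAction.localAction φ v))
      (TreeAction.EdgesAt T v)) :
    TreeAction.VirtuallyIndicable G := by
  let _ : MulAction G V := MulAction.compHom V φ
  have hsmul (g : G) (v : V) : φ g v = g • v := rfl
  have := graphAction_of_forall_eq_smul hsmul
  have := finite_orbitRelQuotient_of_finite_vertexOrbits hsmul horb
  have hsurj : Function.Surjective (dartOrigin G T) := fun v => by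
    by_contra! hempty
    exact hloc v ⟨fun e => (hempty e.1 e.2).elim⟩
  obtain ⟨v⟩ := hT.connected.nonempty
  obtain ⟨d, -⟩ := hsurj v
  have hopen := isOpen_stabilizer_dart hφ hsmul d
  obtain ⟨U₁, _, hstab₁, hlocal⟩ := exists_subgroup_inf_stabilizer_le_fiberStabilizers (G := G)
    hT hsurj fun v => Set.finite_coe_iff.1 (hfin v)
  obtain ⟨U₂, _, hstab₂, hsymm⟩ := exists_subgroup_smul_ne_symm (G := G) hT hsurj
  obtain ⟨f, hf, hker⟩ := exists_surjective_hom_int (G := (U₁ ⊓ U₂ : Subgroup G)) hT hsurj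
    (fun u => hsymm u u.2.2) fun e => exists_notMem_orbit_of_inf_stabilizer_le hsmul
      ((inf_le_inf_right _ inf_le_left).trans (hlocal e.fst)) (hloc e.fst)
  exact ⟨U₁ ⊓ U₂, Subgroup.isOpen_mono (le_inf (hstab₁ d) (hstab₂ d)) hopen, inferInstance, f,
    continuous_of_isOpen_of_le_ker (hopen.preimage continuous_subtype_val) (hker d), hf⟩
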